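/- Setting. Let $n\ge 2$ be an integer and let $r\ge 0$, $R>0$ and $0<\epsilon\le 1$ be real numbers with $\epsilon<R$. Let $$L_{n,\epsilon}=\{(i\epsilon,j\epsilon) : i,j\in\mathbb N,\ i,j\le \sqrt n/\epsilon\},\qquad \Gamma(\mathbf x)=\{\mathbf y\in L_{n,\epsilon} : d(\mathbf x,\mathbf y)\le r\},$$ where $d$ is the Euclidean distance. Each of $n$ nodes performs, independently of the others, a Markov chain on $L_{n,\epsilon}$ that moves in each step from its position $\mathbf x$ to a uniformly random point of $\Gamma(\mathbf x)$; the initial positions are independent, each with the stationary distribution $\pi(\mathbf x)=|\Gamma(\mathbf x)|/\sum_{\mathbf y\in L_{n,\epsilon}}|\Gamma(\mathbf y)|$. Let $P_{i,t}$ be the position of node $i$ at time $t\in\mathbb N$. The stationary geometric-MEG $\mathcal G(n,r,R,\epsilon)$ is the random sequence of graphs $(G_t)_{t\in\mathbb N}$ on the node set $[n]$ in which distinct nodes $i,j$ are adjacent in $G_t$ if and only if $d(P_{i,t},P_{j,t})\le R$. For a source $s\in[n]$ let $I_0=\{s\}$, and let $I_{t+1}$ be the union of $I_t$ and the set of all nodes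 that have a neighbour in $I_t$ in the graph $G_t$. Let $T(s)$ be the least $t$ with $I_t=[n]$ ($\infty$ if there is none). The flooding time is $\max_{s\in[n]}T(s)$. Theorem. There are absolute constants $c,C>0$ such that for all $n,r,R,\epsilon$ as above with $c\sqrt{\log n}\le R\le\sqrt n$ (natural logarithm), the flooding time of the stationary geometric-MEG $\mathcal G(n,r,R,\epsilon)$ is, with probability at least $1-1/n$, finite and at most $$C\left(\frac{\sqrt n}{R}+\log\log R\right).$$ -/

import Mathlib

open MeasureTheory

noncomputable section

namespace GeomMEG

/-! ### Flooding in an evolving graph -/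

/-- The out-neighborhood `N(I)`: nodes outside `I` adjacent to some node of `I`. -/
def outNeighborhood {V : Type*} (G : SimpleGraph V) (I : Set V) : Set V :=
  {v | v ∉ I ∧ ∃ u ∈ I, G.Adj u v}

/-- The set `I_t` of informed nodes: `I_0 = {s}`, `I_{t+1} = I_t ∪ N(I_t)`, where `N` is taken
in the graph at time `t`. -/
def informed {V : Type*} (G : ℕ → SimpleGraph V) (s : V) : ℕ → Set V
  | 0 => {s}
  | t + 1 => informed G s t ∪ outNeighborhood (G t) (informed G s t)

/-- The first time step at which all nodes are informed (`⊤` if there is none). -/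
def completionTime {V : Type*} (G : ℕ → SimpleGraph V) (s : V) : ℕ∞ :=
  ⨅ (t : ℕ) (_ : informed G s t = Set.univ), (t : ℕ∞)

/-- The flooding time: the maximum completion time over all sources. -/
def floodingTime {V : Type*} (G : ℕ → SimpleGraph V) : ℕ∞ :=
  ⨆ s : V, completionTime G s

/-! ### Markov chains on a discrete state space -/

/-- `X` is a time-homogeneous Markov chain with transition probabilities `K`: given any history
up to time `t` that ends in the state `x t`, the next state is `y` with probability `K (x t) y`. -/
def IsMarkovChain {Ω S : Type*} [MeasurableSpace Ω] (μ : Measure Ω) (K : S → S → ℝ)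
    (X : ℕ → Ω → S) : Prop :=
  (∀ (t : ℕ) (x : S), MeasurableSet {ω | X t ω = x}) ∧
  ∀ (t : ℕ) (x : ℕ → S) (y : S),
    μ.real {ω | (∀ k ≤ t, X k ω = x k) ∧ X (t + 1) ω = y} =
      μ.real {ω | ∀ k ≤ t, X k ω = x k} * K (x t) y

/-! ### Geometric Markovian evolving graphs -/

open Classical in
/-- The set `L_{n,ε}` of points `(iε, jε)` with `i, j ∈ ℕ` and `i, j ≤ √n / ε`
(see `mem_grid`). -/
def grid (n : ℕ) (ε : ℝ) : Finset (EuclideanSpace ℝ (Fin 2)) :=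
  (Finset.range (⌊√(n : ℝ) / ε⌋₊ + 1) ×ˢ Finset.range (⌊√(n : ℝ) / ε⌋₊ + 1)).image
    fun ij => !₂[(ij.1 : ℝ) * ε, (ij.2 : ℝ) * ε]

theorem mem_grid {n : ℕ} {ε : ℝ} (hε : 0 < ε) (p : EuclideanSpace ℝ (Fin 2)) :
    p ∈ grid n ε ↔ ∃ i j : ℕ, (i : ℝ) ≤ √(n : ℝ) / ε ∧ (j : ℝ) ≤ √(n : ℝ) / ε ∧
      p = !₂[(i : ℝ) * ε, (j : ℝ) * ε] := by
  have h0 : 0 ≤ √(n : ℝ) / ε := by positivity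
  simp only [grid, Finset.mem_image, Finset.mem_product, Finset.mem_range, Nat.lt_succ_iff,
    Nat.le_floor_iff h0, Prod.exists]
  constructor
  · rintro ⟨i, j, ⟨hi, hj⟩, rfl⟩
    exact ⟨i, j, hi, hj, rfl⟩
  · rintro ⟨i, j, hi, hj, rfl⟩
    exact ⟨i, j, ⟨hi, hj⟩, rfl⟩

open Classical in
/-- `Γ(x)`: the grid points within Euclidean distance `r` of `x`. -/
def moveSet (n : ℕ) (r ε : ℝ) (x : grid n ε) : Finset (grid n ε) :=
  {y | dist (x : EuclideanSpace ℝ (Fin 2)) y ≤ r}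

open Classical in
/-- The one-step transition probability of a single node: uniform on `Γ(x)`. -/
def moveProb (n : ℕ) (r ε : ℝ) (x y : grid n ε) : ℝ :=
  if y ∈ moveSet n r ε x then 1 / ((moveSet n r ε x).card : ℝ) else 0

/-- The stationary distribution of a single node: `π(x) = |Γ(x)| / ∑ y, |Γ(y)|`. -/
def stationaryProb (n : ℕ) (r ε : ℝ) (x : grid n ε) : ℝ :=
  ((moveSet n r ε x).card : ℝ) / ∑ y : grid n ε, ((moveSet n r ε y).card : ℝ)

/-- The transition probability of the chain of all positions: the nodes move independently. -/
def jointMoveProb (n : ℕ) (r ε : ℝ) (x y : Fin n → grid n ε) : ℝ :=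
  ∏ i, moveProb n r ε (x i) (y i)

/-- The stationary distribution of the chain of all positions: the product of the stationary
distributions of the nodes. -/
def jointStationaryProb (n : ℕ) (r ε : ℝ) (x : Fin n → grid n ε) : ℝ :=
  ∏ i, stationaryProb n r ε (x i)

theorem sum_stationaryProb_mul_moveProb (n : ℕ) {r : ℝ} (hr : 0 ≤ r) (ε : ℝ) (y : grid n ε) :
    ∑ x, stationaryProb n r ε x * moveProb n r ε x y = stationaryProb n r ε y := by
  classical
  have key : ∀ x : grid n ε, stationaryProb n r ε x * moveProb n r ε x y =
      (if x ∈ moveSet n r ε y then (1 : ℝ) else 0) /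
        ∑ z : grid n ε, ((moveSet n r ε z).card : ℝ) := by
    intro x
    have hx : x ∈ moveSet n r ε x := by simp [moveSet, hr]
    have hc : ((moveSet n r ε x).card : ℝ) ≠ 0 := by
      exact_mod_cast (Finset.card_pos.2 ⟨x, hx⟩).ne'
    have hs : y ∈ moveSet n r ε x ↔ x ∈ moveSet n r ε y := by
      simp [moveSet, dist_comm]
    unfold stationaryProb moveProb
    by_cases h : x ∈ moveSet n r ε y
    · simp only [hs, h, if_true]
      field_simp
    · simp [hs, h]
  rw [Finset.sum_congr rfl fun x _ => key x, ← Finset.sum_div]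
  simp only [stationaryProb, Finset.sum_ite_mem, Finset.univ_inter, Finset.sum_const,
    nsmul_eq_mul, mul_one]

/-- The product distribution is indeed stationary for the chain of all positions. -/
theorem sum_jointStationaryProb_mul_jointMoveProb (n : ℕ) {r : ℝ} (hr : 0 ≤ r) (ε : ℝ)
    (y : Fin n → grid n ε) :
    ∑ x, jointStationaryProb n r ε x * jointMoveProb n r ε x y =
      jointStationaryProb n r ε y := by
  classical
  simp only [jointStationaryProb, jointMoveProb, ← Finset.prod_mul_distrib]
  rw [← Fintype.prod_sum fun i x => stationaryProb n r ε x * moveProb n r ε x (y i)]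
  simp only [sum_stationaryProb_mul_moveProb n hr ε]

/-- The communication graph of the positions `p`: distinct nodes at Euclidean distance at most `R`
are adjacent. -/
def commGraph {n : ℕ} (R : ℝ) (p : Fin n → EuclideanSpace ℝ (Fin 2)) : SimpleGraph (Fin n) where
  Adj i j := i ≠ j ∧ dist (p i) (p j) ≤ R
  symm := ⟨fun i j h => ⟨h.1.symm, by rw [dist_comm]; exact h.2⟩⟩
  loopless := ⟨fun _ h => h.1 rfl⟩

/-- `G` is a stationary geometric-MEG `𝒢(n, r, R, ε)` on the probability space `(Ω, μ)`: there is
a Markov chain `P` of node positions, started in its (product) stationary distribution, such that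
`G t` is the communication graph of the positions at time `t`. -/
def IsStationaryGeometricMEG {Ω : Type*} [MeasurableSpace Ω] (μ : Measure Ω)
    (n : ℕ) (r R ε : ℝ) (G : ℕ → Ω → SimpleGraph (Fin n)) : Prop :=
  ∃ P : ℕ → Ω → Fin n → grid n ε,
    IsMarkovChain μ (jointMoveProb n r ε) P ∧
    (∀ x, μ.real {ω | P 0 ω = x} = jointStationaryProb n r ε x) ∧
    ∀ t ω, G t ω = commGraph R fun i => (P t ω i : EuclideanSpace ℝ (Fin 2))

end GeomMEG

end

/-!
Cut the square into `m × m` cells with side a small multiple of `R`, so that nodes in the same cell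
or in cells sharing a side are always in contact.

*Balance.* Whatever `r` is, `|Γ(x)|` varies by at most a factor `16` over the grid
(`card_moveSet_le`), so a stationary position lies in a given cell with probability of order
`1 / m²` (`sum_stationaryProb_gridCell`). The positions at any fixed time are independent and
stationary (`IsMarkovChain.measureReal_eq_of_stationary`), and the mean number `n / m²` of nodes in
a cell is of order `R² ≥ c² log n`. For `c` large, the Chernoff bound `sum_prod_le_exp` and a union
bound over the cells and over `O(m)` time steps show that, with probability at least `1 - 1 / n`,
at all these times every cell holds between `q` and `K² q` nodes, where `q` is of order `n / m²` and
`K` is a constant.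

*Spreading.* Given this balance, the rest is deterministic, and independent of how the nodes move
between two steps. Let `I` be the set of informed nodes and `F` the set of cells that contain one.
One step informs all nodes in `F` and in the boundary `∂F`, which is at least `q |∂F|` nodes plus
the uninformed ones in `F`. By the isoperimetric inequality `ncard_le_sq_ncard_outNeighborhood`,
`|F|` or `|Fᶜ|` is at most `|∂F|²`. In the first case `|I| ≤ K² q |F|` makes `√|I|` grow by a
constant times `√q`; in the second one `√|Iᶜ|` decreases by as much, for the same reason
(`LinksCells.potential_add_le`). The potential `√|I| - √|Iᶜ|` has range `2 √n`, so all nodes are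
informed after `O(√(n / q)) = O(m) = O(√n / R)` steps (`informed_eq_univ`). The term `log log R`
in the bound is nonnegative and not needed.
-/

noncomputable section

namespace GeomMEG

/-! ### Vertex isoperimetry in a square grid -/

/-- A set of vertices of a preconnected graph that is neither empty nor everything has a vertex on
its outer boundary. -/
theorem exists_notMem_adj_mem {α : Type*} {G : SimpleGraph α} (hG : G.Preconnected) {S : Set α}
    {a b : α} (ha : a ∈ S) (hb : b ∉ S) : ∃ x ∉ S, ∃ y ∈ S, G.Adj y x := by
  obtain ⟨w⟩ := hG a b
  obtain ⟨d, -, h1, h2⟩ := w.exists_boundary_dart S ha hb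
  exact ⟨d.snd, h2, d.fst, h1, d.adj⟩

/-- A vertex isoperimetric inequality in the square of a connected graph. If no line (row or
column) is contained in `F`, then every line that meets `F` meets the boundary, so `F` lies in the
product of the two projections of the boundary. If every line meets `F`, the same holds for the
complement of `F`. In the remaining case a full and an empty line are parallel, and all the
lines across them meet the boundary. -/
theorem ncard_le_sq_ncard_outNeighborhood {α : Type*} [Finite α] {G : SimpleGraph α}
    (hG : G.Preconnected) (F : Set (α × α)) :
    F.ncard ≤ (outNeighborhood (G □ G) F).ncard ^ 2 ∨
      Fᶜ.ncard ≤ (outNeighborhood (G □ G) F).ncard ^ 2 := by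
  set B := outNeighborhood (G □ G) F with hB
  have hrow : ∀ x y y', (x, y) ∈ F → (x, y') ∉ F → x ∈ Prod.fst '' B := by
    intro x y y' h h'
    obtain ⟨z, hz, w, hw, hzw⟩ := exists_notMem_adj_mem hG (S := {y | (x, y) ∈ F}) h h'
    exact ⟨(x, z), ⟨hz, (x, w), hw, by simp [SimpleGraph.boxProd_adj, hzw]⟩, rfl⟩
  have hcol : ∀ y x x', (x, y) ∈ F → (x', y) ∉ F → y ∈ Prod.snd '' B := by
    intro y x x' h h'
    obtain ⟨z, hz, w, hw, hzw⟩ := exists_notMem_adj_mem hG (S := {x | (x, y) ∈ F}) h h'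
    exact ⟨(z, y), ⟨hz, (w, y), hw, by simp [SimpleGraph.boxProd_adj, hzw]⟩, rfl⟩
  have h1 : (Prod.fst '' B).ncard ≤ B.ncard := Set.ncard_image_le
  have h2 : (Prod.snd '' B).ncard ≤ B.ncard := Set.ncard_image_le
  have hprod : ∀ A : Set (α × α), A ⊆ (Prod.fst '' B) ×ˢ (Prod.snd '' B) →
      A.ncard ≤ B.ncard ^ 2 := by
    intro A hA
    calc A.ncard ≤ ((Prod.fst '' B) ×ˢ (Prod.snd '' B)).ncard := Set.ncard_le_ncard hA
      _ = (Prod.fst '' B).ncard * (Prod.snd '' B).ncard := Set.ncard_prod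
      _ ≤ B.ncard ^ 2 := by rw [sq]; exact Nat.mul_le_mul h1 h2
  have huniv : Nat.card α ≤ B.ncard → F.ncard ≤ B.ncard ^ 2 := by
    intro h
    calc F.ncard ≤ Nat.card (α × α) := Set.ncard_le_card F
      _ = Nat.card α ^ 2 := by rw [Nat.card_prod, sq]
      _ ≤ B.ncard ^ 2 := Nat.pow_le_pow_left h 2
  by_cases hA : (∀ x, ∃ y, (x, y) ∉ F) ∧ ∀ y, ∃ x, (x, y) ∉ F
  · left
    apply hprod
    rintro ⟨x, y⟩ h
    obtain ⟨y', hy'⟩ := hA.1 x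
    obtain ⟨x', hx'⟩ := hA.2 y
    exact ⟨hrow x y y' h hy', hcol y x x' h hx'⟩
  by_cases hA' : (∀ x, ∃ y, (x, y) ∈ F) ∧ ∀ y, ∃ x, (x, y) ∈ F
  · right
    apply hprod
    rintro ⟨x, y⟩ h
    obtain ⟨y', hy'⟩ := hA'.1 x
    obtain ⟨x', hx'⟩ := hA'.2 y
    exact ⟨hrow x y' y hy' h, hcol y x' x hx' h⟩
  left
  apply huniv
  have hfull : (∀ x, x ∈ Prod.fst '' B) ∨ ∀ y, y ∈ Prod.snd '' B := by
    by_cases hx : ∃ x, ∀ y, (x, y) ∈ F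
    · obtain ⟨x, hx⟩ := hx
      obtain ⟨x', hx'⟩ : ∃ x', ∀ y, (x', y) ∉ F := by
        by_contra! h
        exact hA' ⟨h, fun y => ⟨x, hx y⟩⟩
      exact Or.inr fun y => hcol y x x' (hx y) (hx' y)
    · push Not at hx
      obtain ⟨y, hy⟩ : ∃ y, ∀ x, (x, y) ∈ F := by
        by_contra! h
        exact hA ⟨hx, h⟩
      obtain ⟨y', hy'⟩ : ∃ y', ∀ x, (x, y') ∉ F := by
        by_contra! h
        exact hA' ⟨fun x => ⟨y, hy x⟩, h⟩
      exact Or.inl fun x => hrow x y y' (hy x) (hy' x)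
  rcases hfull with h | h
  · rwa [Set.eq_univ_of_forall h, Set.ncard_univ] at h1
  · rwa [Set.eq_univ_of_forall h, Set.ncard_univ] at h2

/-! ### Spreading of information between balanced cells -/

/-- The graph of the `m × m` cells, in which cells that share a side are adjacent. -/
def cellGraph (m : ℕ) : SimpleGraph (Fin m × Fin m) :=
  SimpleGraph.pathGraph m □ SimpleGraph.pathGraph m

/-- Every cell of the assignment `κ` of nodes to cells holds between `q` and `Q` nodes. -/
def IsBalanced {V W : Type*} (κ : V → W) (q Q : ℝ) : Prop :=
  ∀ c, q ≤ ((κ ⁻¹' {c}).ncard : ℝ) ∧ ((κ ⁻¹' {c}).ncard : ℝ) ≤ Q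

/-- Any two nodes in the same cell or in cells sharing a side are adjacent in `G`. -/
def LinksCells {V : Type*} {m : ℕ} (G : SimpleGraph V) (κ : V → Fin m × Fin m) : Prop :=
  ∀ u v, u ≠ v → κ u = κ v ∨ (cellGraph m).Adj (κ u) (κ v) → G.Adj u v

theorem ncard_preimage_eq_sum {V W : Type*} [Finite V] [Fintype W] (κ : V → W) (A : Set W)
    [DecidablePred (· ∈ A)] :
    (κ ⁻¹' A).ncard = ∑ c with c ∈ A, (κ ⁻¹' {c}).ncard := by
  classical
  have := Fintype.ofFinite V
  have h : ∀ S : Set W, (κ ⁻¹' S).ncard = (Finset.univ.filter fun v => κ v ∈ S).card := by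
    intro S
    rw [← Set.ncard_coe_finset]
    congr 1
    ext v
    simp
  rw [h, Finset.card_eq_sum_card_fiberwise (f := κ) (t := Finset.univ.filter fun c => c ∈ A)]
  · refine Finset.sum_congr rfl fun c hc => ?_
    rw [h, Finset.filter_filter]
    congr 1
    ext v
    simp only [Finset.mem_filter, Finset.mem_univ, true_and, Set.mem_singleton_iff] at hc ⊢
    exact ⟨fun h => h.2, fun h => ⟨h ▸ hc, h⟩⟩
  · intro v hv
    simpa using hv

theorem IsBalanced.ncard_preimage {V W : Type*} [Finite V] [Finite W] {κ : V → W} {q Q : ℝ}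
    (h : IsBalanced κ q Q) (A : Set W) :
    q * A.ncard ≤ (κ ⁻¹' A).ncard ∧ ((κ ⁻¹' A).ncard : ℝ) ≤ Q * A.ncard := by
  classical
  have := Fintype.ofFinite W
  have hA : A.ncard = (Finset.univ.filter fun c => c ∈ A).card := by
    rw [← Set.ncard_coe_finset]
    congr 1
    ext v
    simp
  rw [ncard_preimage_eq_sum, hA]
  push_cast
  constructor
  · rw [mul_comm, ← nsmul_eq_mul]
    exact Finset.card_nsmul_le_sum _ _ _ fun c _ => (h c).1
  · rw [mul_comm, ← nsmul_eq_mul]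
    exact Finset.sum_le_card_nsmul _ _ _ fun c _ => (h c).2

section Step

variable {V : Type*} {m : ℕ} {G : SimpleGraph V} {κ : V → Fin m × Fin m} {q Q : ℝ}

/-- After one step, all nodes in the cells that held an informed node, and in the cells next to
these, are informed. -/
theorem LinksCells.preimage_subset (hG : LinksCells G κ) (I : Set V) :
    κ ⁻¹' (κ '' I ∪ outNeighborhood (cellGraph m) (κ '' I)) ⊆ I ∪ outNeighborhood G I := by
  intro v hv
  by_cases hvI : v ∈ I
  · exact Or.inl hvI
  refine Or.inr ⟨hvI, ?_⟩
  rcases hv with ⟨u, hu, huv⟩ | ⟨-, _, ⟨u, hu, rfl⟩, huv⟩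
  · exact ⟨u, hu, hG u v (fun h => hvI (h ▸ hu)) (Or.inl huv)⟩
  · exact ⟨u, hu, hG u v (fun h => hvI (h ▸ hu)) (Or.inr huv)⟩

/-- The nodes that become informed include the uninformed nodes in cells that are already reached
and all the nodes in the boundary cells. -/
theorem LinksCells.add_le_ncard [Finite V] (hG : LinksCells G κ) (hκ : IsBalanced κ q Q)
    (I : Set V) :
    (I.ncard : ℝ) + (κ ⁻¹' (κ '' I) \ I).ncard +
      q * (outNeighborhood (cellGraph m) (κ '' I)).ncard ≤ (I ∪ outNeighborhood G I).ncard := by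
  have h1 := Set.ncard_le_ncard (hG.preimage_subset I)
  have hd : Disjoint (κ ⁻¹' (κ '' I)) (κ ⁻¹' outNeighborhood (cellGraph m) (κ '' I)) :=
    Set.disjoint_left.2 fun v h h' => h'.1 h
  rw [Set.preimage_union, Set.ncard_union_eq hd] at h1
  have h2 := Set.ncard_sdiff_add_ncard_of_subset (Set.subset_preimage_image κ I)
  have h3 := (hκ.ncard_preimage (outNeighborhood (cellGraph m) (κ '' I))).1
  have h4 : (((κ ⁻¹' (κ '' I) \ I).ncard : ℝ) + I.ncard) +
      (κ ⁻¹' outNeighborhood (cellGraph m) (κ '' I)).ncard ≤ (I ∪ outNeighborhood G I).ncard := by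
    rw [← h2] at h1
    exact_mod_cast h1
  linarith

/-- A set of informed nodes that is not empty fills a cell after one step. -/
theorem LinksCells.le_ncard_of_nonempty [Finite V] (hG : LinksCells G κ)
    (hκ : IsBalanced κ q Q) {I : Set V} (hI : I.Nonempty) :
    q ≤ (I ∪ outNeighborhood G I).ncard := by
  obtain ⟨v, hv⟩ := hI
  refine (hκ (κ v)).1.trans (Nat.cast_le.2 (Set.ncard_le_ncard ?_))
  refine (Set.preimage_mono ?_).trans (hG.preimage_subset I)
  rintro _ rfl
  exact Or.inl ⟨v, hv, rfl⟩

/-- If the uninformed nodes are too few to fill a cell, then all are informed one step later. -/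
theorem LinksCells.eq_univ_of_ncard_compl_lt [Finite V] (hG : LinksCells G κ)
    (hκ : IsBalanced κ q Q) {I : Set V} (hI : (Iᶜ.ncard : ℝ) < q) :
    I ∪ outNeighborhood G I = Set.univ := by
  refine Set.univ_subset_iff.1 fun v _ => hG.preimage_subset I (Or.inl ?_)
  by_contra h
  have : κ ⁻¹' {κ v} ⊆ Iᶜ := fun u hu huI => h ⟨u, huI, hu⟩
  have h2 : ((κ ⁻¹' {κ v}).ncard : ℝ) ≤ Iᶜ.ncard := Nat.cast_le.2 (Set.ncard_le_ncard this)
  linarith [(hκ (κ v)).1]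

/-- The potential `√|I| - √|Iᶜ|` of the set `I` of informed nodes grows by a fixed amount in each
step: when the set of reached cells satisfies the isoperimetric inequality, the first term grows,
and when the set of the other cells does, the second one shrinks. -/
theorem LinksCells.potential_add_le [Finite V] (hG : LinksCells G κ) {K : ℝ} (hK : 1 ≤ K)
    (hq : 0 < q) (hκ : IsBalanced κ q (K ^ 2 * q)) {I : Set V} (hI : q ≤ I.ncard)
    (hI' : q ≤ Iᶜ.ncard) :
    √(I.ncard : ℝ) - √(Iᶜ.ncard : ℝ) + √q / (4 * K) ≤
      √((I ∪ outNeighborhood G I).ncard : ℝ) - √((I ∪ outNeighborhood G I)ᶜ.ncard : ℝ) := by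
  set I' := I ∪ outNeighborhood G I with hI'def
  set F := κ '' I with hF
  set b : ℝ := ((outNeighborhood (cellGraph m) F).ncard : ℝ) with hb
  set e : ℝ := ((κ ⁻¹' F \ I).ncard : ℝ) with he
  have hmain : (I.ncard : ℝ) + e + q * b ≤ I'.ncard := hG.add_le_ncard hκ I
  have hcard : (I.ncard : ℝ) + Iᶜ.ncard = I'.ncard + I'ᶜ.ncard := by
    exact_mod_cast (Set.ncard_add_ncard_compl I).trans (Set.ncard_add_ncard_compl I').symm
  have hb0 : 0 ≤ b := Nat.cast_nonneg _
  have he0 : 0 ≤ e := Nat.cast_nonneg _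
  set σ := √q with hσ
  have hσ0 : 0 < σ := Real.sqrt_pos.2 hq
  have hσq : σ ^ 2 = q := Real.sq_sqrt hq.le
  set x := σ / (4 * K) with hx
  have hx0 : 0 < x := by positivity
  have hxK : x * (4 * K) = σ := by rw [hx]; field_simp
  have hxσ : 4 * x ≤ σ := by nlinarith only [hx0, hK, hxK]
  set h := √(I.ncard : ℝ) with hh
  set u := √(Iᶜ.ncard : ℝ) with hu
  have hh2 : h ^ 2 = I.ncard := Real.sq_sqrt (Nat.cast_nonneg _)
  have hu2 : u ^ 2 = Iᶜ.ncard := Real.sq_sqrt (Nat.cast_nonneg _)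
  have hσh : σ ≤ h := Real.sqrt_le_sqrt hI
  have hσu : σ ≤ u := Real.sqrt_le_sqrt hI'
  have hqb : 0 ≤ q * b := by positivity
  -- it suffices to move one of the two terms, as the other one is monotone
  have hmono1 : h ≤ √(I'.ncard : ℝ) := Real.sqrt_le_sqrt (by linarith)
  have hmono2 : √(I'ᶜ.ncard : ℝ) ≤ u := Real.sqrt_le_sqrt (by linarith)
  rcases ncard_le_sq_ncard_outNeighborhood (SimpleGraph.pathGraph_preconnected m) F with hiso | hiso
  · have hiso' : (F.ncard : ℝ) ≤ b ^ 2 := by rw [hb]; exact_mod_cast hiso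
    have h1 : (I.ncard : ℝ) ≤ K ^ 2 * q * F.ncard :=
      (Nat.cast_le.2 (Set.ncard_le_ncard (Set.subset_preimage_image κ I))).trans
        (hκ.ncard_preimage F).2
    have h2 : h ≤ K * σ * b := by
      refine (pow_le_pow_iff_left₀ (Real.sqrt_nonneg _) (by positivity) two_ne_zero).1 ?_
      rw [hh2, mul_pow, mul_pow, hσq]
      exact h1.trans (by gcongr)
    have h3 : h + x ≤ √(I'.ncard : ℝ) := by
      apply Real.le_sqrt_of_sq_le
      have : 4 * x * h ≤ q * b := by
        calc 4 * x * h ≤ 4 * x * (K * σ * b) := by gcongr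
          _ = (x * (4 * K)) * σ * b := by ring
          _ = q * b := by rw [hxK, ← hσq]; ring
      have hxh : 0 ≤ x * (h - x) := mul_nonneg hx0.le (by linarith)
      linarith only [this, hxh, hmain, hh2, he0, show (h + x) ^ 2 = h ^ 2 + 3 * x * h -
        x * (h - x) by ring, mul_nonneg hx0.le (Real.sqrt_nonneg (I.ncard : ℝ))]
    linarith
  · have hiso' : (Fᶜ.ncard : ℝ) ≤ b ^ 2 := by rw [hb]; exact_mod_cast hiso
    have h1 : (Iᶜ.ncard : ℝ) ≤ e + K ^ 2 * q * Fᶜ.ncard := by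
      have hsub : Iᶜ ⊆ (κ ⁻¹' F \ I) ∪ κ ⁻¹' Fᶜ := by
        intro v hv
        by_cases hvF : κ v ∈ F
        · exact Or.inl ⟨hvF, hv⟩
        · exact Or.inr hvF
      have h2 := (Set.ncard_le_ncard hsub).trans (Set.ncard_union_le _ _)
      have h3 : (Iᶜ.ncard : ℝ) ≤ e + (κ ⁻¹' Fᶜ).ncard := by rw [he]; exact_mod_cast h2
      linarith [(hκ.ncard_preimage Fᶜ).2]
    have h2 : K ^ 2 * q * Fᶜ.ncard ≤ (K * σ * b) ^ 2 := by
      rw [mul_pow, mul_pow, hσq]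
      gcongr
    -- either half of the uninformed nodes are in reached cells, or half are in the other cells
    have h3 : 2 * x * u ≤ e + q * b := by
      by_cases hcase : u ^ 2 ≤ 2 * e
      · have hxu : 0 ≤ u * (u - 4 * x) := mul_nonneg (Real.sqrt_nonneg _) (by linarith)
        linarith only [hxu, hcase, hqb, show u * (u - 4 * x) = u ^ 2 - 4 * x * u by ring]
      · have : u ≤ 2 * (K * σ * b) := by
          refine (pow_le_pow_iff_left₀ (Real.sqrt_nonneg _) (by positivity) two_ne_zero).1 ?_
          linarith only [hcase, h1, h2, hu2,
            show (2 * (K * σ * b)) ^ 2 = 4 * (K * σ * b) ^ 2 by ring, sq_nonneg (K * σ * b)]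
        calc 2 * x * u ≤ 2 * x * (2 * (K * σ * b)) := by gcongr
          _ = (x * (4 * K)) * σ * b := by ring
          _ = q * b := by rw [hxK, ← hσq]; ring
          _ ≤ e + q * b := by linarith
    have h4 : √(I'ᶜ.ncard : ℝ) ≤ u - x := by
      apply Real.sqrt_le_iff.2 ⟨by linarith, ?_⟩
      linarith only [sq_nonneg x, h3, hcard, hmain, hu2,
        show (u - x) ^ 2 = u ^ 2 - 2 * x * u + x ^ 2 by ring]
    linarith

end Step

theorem informed_nonempty {V : Type*} (G : ℕ → SimpleGraph V) (s : V) (t : ℕ) :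
    (informed G s t).Nonempty := by
  induction t with
  | zero => exact ⟨s, rfl⟩
  | succ t ih => exact ih.mono Set.subset_union_left

/-- If at all times up to `T` the nodes are balanced over cells in which they are linked, then
flooding takes at most `T + 1` steps, provided that the potential, which ranges over an interval of
length `2 √|V|`, cannot grow for `T` steps. -/
theorem informed_eq_univ {V : Type*} [Finite V] {m T : ℕ} {G : ℕ → SimpleGraph V}
    {κ : ℕ → V → Fin m × Fin m} {K q : ℝ} (hK : 1 ≤ K) (hq : 0 < q)
    (hG : ∀ t ≤ T, LinksCells (G t) (κ t)) (hκ : ∀ t ≤ T, IsBalanced (κ t) q (K ^ 2 * q))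
    (hT : 2 * √(Nat.card V : ℝ) < T * (√q / (4 * K))) (s : V) :
    informed G s (T + 1) = Set.univ := by
  have key : ∀ t ≤ T, informed G s (t + 1) = Set.univ ∨
      q ≤ (informed G s (t + 1)).ncard ∧ -√(Nat.card V : ℝ) + t * (√q / (4 * K)) ≤
        √((informed G s (t + 1)).ncard : ℝ) - √((informed G s (t + 1))ᶜ.ncard : ℝ) := by
    intro t
    induction t with
    | zero =>
      intro _
      refine Or.inr ⟨(hG 0 (Nat.zero_le _)).le_ncard_of_nonempty (hκ 0 (Nat.zero_le _))
        (informed_nonempty G s 0), ?_⟩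
      have h1 : √((informed G s (0 + 1))ᶜ.ncard : ℝ) ≤ √(Nat.card V : ℝ) :=
        Real.sqrt_le_sqrt (Nat.cast_le.2 (Set.ncard_le_card _))
      have h2 := Real.sqrt_nonneg ((informed G s (0 + 1)).ncard : ℝ)
      push_cast
      linarith
    | succ t ih =>
      intro ht
      rcases ih (by omega) with h | ⟨h1, h2⟩
      · left
        rw [informed, h, Set.univ_union]
      by_cases hlt : ((informed G s (t + 1))ᶜ.ncard : ℝ) < q
      · exact Or.inl ((hG _ ht).eq_univ_of_ncard_compl_lt (hκ _ ht) hlt)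
      · right
        refine ⟨(hG _ ht).le_ncard_of_nonempty (hκ _ ht) (informed_nonempty G s _), ?_⟩
        have := (hG _ ht).potential_add_le hK hq (hκ _ ht) h1 (not_lt.1 hlt)
        rw [informed]
        push_cast
        linarith
  rcases key T le_rfl with h | ⟨-, h⟩
  · exact h
  · exfalso
    have h1 : √((informed G s (T + 1)).ncard : ℝ) ≤ √(Nat.card V : ℝ) :=
      Real.sqrt_le_sqrt (Nat.cast_le.2 (Set.ncard_le_card _))
    have h2 := Real.sqrt_nonneg ((informed G s (T + 1))ᶜ.ncard : ℝ)
    linarith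

theorem floodingTime_le {V : Type*} {G : ℕ → SimpleGraph V} {T : ℕ}
    (h : ∀ s, informed G s T = Set.univ) : floodingTime G ≤ T :=
  iSup_le fun s => iInf₂_le T (h s)

/-! ### Marginals of a stationary chain -/

theorem measureReal_eq_sum_inter_fiber {Ω β : Type*} [MeasurableSpace Ω] [Fintype β]
    (μ : Measure Ω) [IsFiniteMeasure μ] {f : Ω → β} (hf : ∀ b, MeasurableSet {ω | f ω = b})
    {A : Set Ω} (hA : MeasurableSet A) :
    μ.real A = ∑ b, μ.real (A ∩ {ω | f ω = b}) := by
  rw [← measureReal_iUnion_fintype]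
  · congr 1
    ext ω
    simp
  · intro b b' hb
    exact Set.disjoint_left.2 fun ω h h' => hb (h.2.symm.trans h'.2)
  · exact fun b => hA.inter (hf b)

/-- The transition probabilities, conditioned on the present state only: sum over the history. -/
theorem IsMarkovChain.measureReal_succ {Ω S : Type*} [MeasurableSpace Ω] [Fintype S]
    {μ : Measure Ω} [IsFiniteMeasure μ] {K : S → S → ℝ} {X : ℕ → Ω → S}
    (h : IsMarkovChain μ K X) (t : ℕ) (x y : S) :
    μ.real ({ω | X t ω = x} ∩ {ω | X (t + 1) ω = y}) = μ.real {ω | X t ω = x} * K x y := by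
  classical
  have hm : ∀ g : Fin t → S, MeasurableSet {ω | (fun k : Fin t => X k ω) = g} := by
    intro g
    have : {ω | (fun k : Fin t => X k ω) = g} = ⋂ k : Fin t, {ω | X k ω = g k} := by
      ext ω
      simp [funext_iff]
    rw [this]
    exact MeasurableSet.iInter fun k => h.1 k (g k)
  rw [measureReal_eq_sum_inter_fiber μ hm ((h.1 t x).inter (h.1 (t + 1) y)),
    measureReal_eq_sum_inter_fiber μ hm (h.1 t x), Finset.sum_mul]
  refine Finset.sum_congr rfl fun g _ => ?_
  have hpath : ∀ ω, (∀ k ≤ t, X k ω = if hk : k < t then g ⟨k, hk⟩ else x) ↔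
      X t ω = x ∧ (fun k : Fin t => X k ω) = g := by
    intro ω
    constructor
    · intro hω
      refine ⟨by simpa using hω t le_rfl, funext fun k => ?_⟩
      simpa using hω k k.2.le
    · rintro ⟨h1, h2⟩ k hk
      rcases hk.lt_or_eq with hk' | rfl
      · simp only [hk', dif_pos]
        exact congrFun h2 ⟨k, hk'⟩
      · simpa using h1
  have := h.2 t (fun k => if hk : k < t then g ⟨k, hk⟩ else x) y
  simp only [hpath, lt_irrefl, dif_neg, not_false_eq_true] at this
  convert this using 2
  · ext ω
    exact and_right_comm
  · rfl

theorem IsMarkovChain.measureReal_eq_of_stationary {Ω S : Type*} [MeasurableSpace Ω] [Fintype S]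
    {μ : Measure Ω} [IsFiniteMeasure μ] {K : S → S → ℝ} {X : ℕ → Ω → S}
    (h : IsMarkovChain μ K X) {ρ : S → ℝ} (h0 : ∀ x, μ.real {ω | X 0 ω = x} = ρ x)
    (hρ : ∀ y, ∑ x, ρ x * K x y = ρ y) (t : ℕ) (y : S) : μ.real {ω | X t ω = y} = ρ y := by
  induction t generalizing y with
  | zero => exact h0 y
  | succ t ih =>
    rw [measureReal_eq_sum_inter_fiber μ (h.1 t) (h.1 (t + 1) y), ← hρ y]
    refine Finset.sum_congr rfl fun x _ => ?_
    rw [Set.inter_comm, h.measureReal_succ, ih]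

open Classical in
theorem measureReal_mem_eq_sum {Ω S : Type*} [MeasurableSpace Ω] [Fintype S]
    {μ : Measure Ω} [IsFiniteMeasure μ] {X : Ω → S}
    (hX : ∀ x, MeasurableSet {ω | X ω = x}) (B : Set S) :
    μ.real {ω | X ω ∈ B} = ∑ x with x ∈ B, μ.real {ω | X ω = x} := by
  rw [← measureReal_biUnion_finset]
  · congr 1
    ext ω
    simp
  · intro b _ b' _ hb
    exact Set.disjoint_left.2 fun ω h h' => hb (Eq.trans (Eq.symm h) h')
  · exact fun b _ => hX b

/-! ### A Chernoff bound for product distributions -/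

open Classical in
/-- Exponential Markov inequality for the number of coordinates in `A`, when the coordinates are
independent with distribution `ρ`: the sum on the left is the probability of the event `B`, on
which that number, times `θ`, is at least `a`. -/
theorem sum_prod_le_exp {ι S : Type*} [Fintype ι] [DecidableEq ι] [Fintype S]
    {ρ : S → ℝ} (hρ : ∀ x, 0 ≤ ρ x)
    (hρ1 : ∑ x, ρ x = 1) (A : Set S) (θ a : ℝ) {B : Set (ι → S)}
    (hB : ∀ x ∈ B, a ≤ θ * ((x ⁻¹' A).ncard : ℝ)) :
    ∑ x with x ∈ B, ∏ i, ρ (x i) ≤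
      Real.exp (Fintype.card ι * ((∑ x with x ∈ A, ρ x) * (Real.exp θ - 1)) - a) := by
  set p := ∑ x with x ∈ A, ρ x with hp
  have hcount : ∀ x : ι → S, Real.exp (θ * ((x ⁻¹' A).ncard : ℝ)) =
      ∏ i, (if x i ∈ A then Real.exp θ else 1) := by
    intro x
    have h1 : (x ⁻¹' A).ncard = (Finset.univ.filter fun i => x i ∈ A).card := by
      rw [← Set.ncard_coe_finset]
      congr 1
      ext i
      simp
    rw [Finset.prod_ite, Finset.prod_const, Finset.prod_const_one, mul_one, h1, mul_comm,
      Real.exp_nat_mul]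
  have hmgf : ∑ x, ρ x * (if x ∈ A then Real.exp θ else 1) = 1 + p * (Real.exp θ - 1) := by
    have : ∀ x, ρ x * (if x ∈ A then Real.exp θ else 1) =
        ρ x + (if x ∈ A then ρ x else 0) * (Real.exp θ - 1) := by
      intro x
      split_ifs <;> ring
    simp_rw [this]
    rw [Finset.sum_add_distrib, hρ1, ← Finset.sum_mul, hp, Finset.sum_filter]
  have hpos : 0 ≤ 1 + p * (Real.exp θ - 1) := by
    rw [← hmgf]
    exact Finset.sum_nonneg fun x _ => mul_nonneg (hρ x) (by split_ifs <;> positivity)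
  calc ∑ x with x ∈ B, ∏ i, ρ (x i)
      ≤ ∑ x with x ∈ B, (∏ i, ρ (x i)) * Real.exp (θ * ((x ⁻¹' A).ncard : ℝ) - a) := by
        refine Finset.sum_le_sum fun x hx => ?_
        refine le_mul_of_one_le_right (Finset.prod_nonneg fun i _ => hρ _) ?_
        exact Real.one_le_exp (sub_nonneg.2 (hB x (Finset.mem_filter.1 hx).2))
    _ ≤ ∑ x : ι → S, (∏ i, ρ (x i)) * Real.exp (θ * ((x ⁻¹' A).ncard : ℝ) - a) :=
        Finset.sum_le_sum_of_subset_of_nonneg (Finset.filter_subset _ _) fun x _ _ =>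
          mul_nonneg (Finset.prod_nonneg fun i _ => hρ _) (Real.exp_nonneg _)
    _ = (∑ x : ι → S, ∏ i, ρ (x i) * (if x i ∈ A then Real.exp θ else 1)) * Real.exp (-a) := by
        rw [Finset.sum_mul]
        refine Finset.sum_congr rfl fun x _ => ?_
        rw [sub_eq_add_neg, Real.exp_add, hcount, Finset.prod_mul_distrib, mul_assoc]
    _ = (1 + p * (Real.exp θ - 1)) ^ Fintype.card ι * Real.exp (-a) := by
        rw [← Fintype.prod_sum fun (_ : ι) x => ρ x * (if x ∈ A then Real.exp θ else 1), hmgf,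
          Finset.prod_const, Finset.card_univ]
    _ ≤ Real.exp (p * (Real.exp θ - 1)) ^ Fintype.card ι * Real.exp (-a) := by
        gcongr
        linarith [Real.add_one_le_exp (p * (Real.exp θ - 1))]
    _ = _ := by rw [← Real.exp_nat_mul, ← Real.exp_add, ← sub_eq_add_neg]

/-! ### The grid in coordinates -/

/-- The number of grid points on a side of the square. -/
def gridSize (n : ℕ) (ε : ℝ) : ℕ := ⌊√(n : ℝ) / ε⌋₊ + 1

theorem gridSize_pos (n : ℕ) (ε : ℝ) : 0 < gridSize n ε := Nat.succ_pos _

/-- The grid, indexed by the pairs `(i, j)` that define its points `(iε, jε)`. -/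
def gridEquiv (n : ℕ) {ε : ℝ} (hε : 0 < ε) :
    Fin (gridSize n ε) × Fin (gridSize n ε) ≃ grid n ε :=
  Equiv.ofBijective
    (fun a => ⟨!₂[((a.1 : ℕ) : ℝ) * ε, ((a.2 : ℕ) : ℝ) * ε], (mem_grid hε _).2
      ⟨a.1, a.2, (Nat.le_floor_iff (by positivity)).1 (Nat.lt_succ_iff.1 a.1.2),
        (Nat.le_floor_iff (by positivity)).1 (Nat.lt_succ_iff.1 a.2.2), rfl⟩⟩) <| by
    constructor
    · intro a b h
      have h1 := congrArg (fun x : grid n ε => (x : EuclideanSpace ℝ (Fin 2)) 0) h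
      have h2 := congrArg (fun x : grid n ε => (x : EuclideanSpace ℝ (Fin 2)) 1) h
      simp only [Matrix.cons_val_zero, Matrix.cons_val_one, mul_eq_mul_right_iff,
        Nat.cast_inj, hε.ne', or_false] at h1 h2
      exact Prod.ext (Fin.ext h1) (Fin.ext h2)
    · rintro ⟨p, hp⟩
      obtain ⟨i, j, hi, hj, rfl⟩ := (mem_grid hε p).1 hp
      exact ⟨(⟨i, Nat.lt_succ_iff.2 (Nat.le_floor hi)⟩, ⟨j, Nat.lt_succ_iff.2 (Nat.le_floor hj)⟩),
        rfl⟩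

section Coordinates

variable {n : ℕ} {ε : ℝ} (hε : 0 < ε) (a b : Fin (gridSize n ε) × Fin (gridSize n ε))

theorem dist_gridEquiv :
    dist (gridEquiv n hε a : EuclideanSpace ℝ (Fin 2)) (gridEquiv n hε b) =
      √((((a.1 : ℕ) : ℝ) - (b.1 : ℕ)) ^ 2 + (((a.2 : ℕ) : ℝ) - (b.2 : ℕ)) ^ 2) * ε := by
  rw [EuclideanSpace.dist_eq, Fin.sum_univ_two, Real.dist_eq, Real.dist_eq, sq_abs, sq_abs]
  have h : ∀ c, (gridEquiv n hε c : EuclideanSpace ℝ (Fin 2)) 0 = ((c.1 : ℕ) : ℝ) * ε ∧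
      (gridEquiv n hε c : EuclideanSpace ℝ (Fin 2)) 1 = ((c.2 : ℕ) : ℝ) * ε := fun c => ⟨rfl, rfl⟩
  rw [(h a).1, (h a).2, (h b).1, (h b).2, ← sub_mul, ← sub_mul, mul_pow, mul_pow, ← add_mul,
    Real.sqrt_mul (by positivity), Real.sqrt_sq hε.le]

theorem abs_fst_sub_le_dist : |((a.1 : ℕ) : ℝ) - (b.1 : ℕ)| * ε ≤
    dist (gridEquiv n hε a : EuclideanSpace ℝ (Fin 2)) (gridEquiv n hε b) := by
  rw [dist_gridEquiv]
  gcongr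
  exact Real.abs_le_sqrt (le_add_of_nonneg_right (sq_nonneg _))

theorem abs_snd_sub_le_dist : |((a.2 : ℕ) : ℝ) - (b.2 : ℕ)| * ε ≤
    dist (gridEquiv n hε a : EuclideanSpace ℝ (Fin 2)) (gridEquiv n hε b) := by
  rw [dist_gridEquiv]
  gcongr
  exact Real.abs_le_sqrt (le_add_of_nonneg_left (sq_nonneg _))

theorem dist_le_abs_add_abs :
    dist (gridEquiv n hε a : EuclideanSpace ℝ (Fin 2)) (gridEquiv n hε b) ≤
      (|((a.1 : ℕ) : ℝ) - (b.1 : ℕ)| + |((a.2 : ℕ) : ℝ) - (b.2 : ℕ)|) * ε := by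
  rw [dist_gridEquiv]
  gcongr
  rw [Real.sqrt_le_left (by positivity), ← sq_abs (((a.1 : ℕ) : ℝ) - _),
    ← sq_abs (((a.2 : ℕ) : ℝ) - _)]
  nlinarith [abs_nonneg (((a.1 : ℕ) : ℝ) - (b.1 : ℕ)), abs_nonneg (((a.2 : ℕ) : ℝ) - (b.2 : ℕ))]

end Coordinates

/-! ### The stationary distribution is nearly uniform -/

/-- The indices within distance `s` of `i`. -/
def window {N : ℕ} (s : ℕ) (i : Fin N) : Finset (Fin N) :=
  {j | (i : ℕ) ≤ j + s ∧ (j : ℕ) ≤ i + s}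

/-- Halving the width and moving the center, even to an end of the range, costs at most a factor
`4`. -/
theorem card_window_le {N : ℕ} (s : ℕ) (i j : Fin N) :
    (window s i).card ≤ 4 * (window (s / 2) j).card := by
  have hi := i.2
  have hj := j.2
  have hup : (window s i).card ≤ min (2 * s + 1) N := by
    have hsub : window s i ⊆ Finset.Icc (⟨i - s, by omega⟩ : Fin N)
        ⟨min (i + s) (N - 1), by omega⟩ := by
      intro k hk
      have := k.2
      simp only [window, Finset.mem_filter, Finset.mem_univ, true_and] at hk
      simp only [Finset.mem_Icc, Fin.le_def]
      omega
    have := Finset.card_le_card hsub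
    rw [Fin.card_Icc] at this
    dsimp only at this
    omega
  have hlow : min (s / 2) ((N - 1) / 2) + 1 ≤ (window (s / 2) j).card := by
    by_cases hc : (j : ℕ) ≤ (N - 1) / 2
    · have hsub : Finset.Icc j (⟨j + min (s / 2) ((N - 1) / 2), by omega⟩ : Fin N) ⊆
          window (s / 2) j := by
        intro k hk
        simp only [Finset.mem_Icc, Fin.le_def] at hk
        simp only [window, Finset.mem_filter, Finset.mem_univ, true_and]
        omega
      have := Finset.card_le_card hsub
      rw [Fin.card_Icc] at this
      dsimp only at this
      omega
    · have hsub : Finset.Icc (⟨j - min (s / 2) ((N - 1) / 2), by omega⟩ : Fin N) j ⊆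
          window (s / 2) j := by
        intro k hk
        simp only [Finset.mem_Icc, Fin.le_def] at hk
        simp only [window, Finset.mem_filter, Finset.mem_univ, true_and]
        omega
      have := Finset.card_le_card hsub
      rw [Fin.card_Icc] at this
      dsimp only at this
      omega
  omega

section Moves

variable {n : ℕ} {r ε : ℝ}

theorem card_moveSet_le_window (hε : 0 < ε) (a : Fin (gridSize n ε) × Fin (gridSize n ε)) :
    (moveSet n r ε (gridEquiv n hε a)).card ≤
      (window ⌊r / ε⌋₊ a.1).card * (window ⌊r / ε⌋₊ a.2).card := by
  rw [← Finset.card_product, ← Finset.card_map (gridEquiv n hε).toEmbedding]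
  refine Finset.card_le_card fun y hy => ?_
  obtain ⟨b, rfl⟩ := (gridEquiv n hε).surjective y
  have hd : dist (gridEquiv n hε a : EuclideanSpace ℝ (Fin 2)) (gridEquiv n hε b) ≤ r := by
    simpa [moveSet] using hy
  have hwin : ∀ i j : Fin (gridSize n ε), |((i : ℕ) : ℝ) - (j : ℕ)| * ε ≤ r →
      j ∈ window ⌊r / ε⌋₊ i := by
    intro i j hij
    rw [← le_div_iff₀ hε, abs_le] at hij
    simp only [window, Finset.mem_filter, Finset.mem_univ, true_and]
    constructor
    · rw [← Nat.sub_le_iff_le_add']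
      apply Nat.le_floor
      rcases le_total (i : ℕ) j with h | h
      · rw [Nat.sub_eq_zero_of_le h, Nat.cast_zero]
        linarith
      · rw [Nat.cast_sub h]
        exact hij.2
    · rw [← Nat.sub_le_iff_le_add']
      apply Nat.le_floor
      rcases le_total (j : ℕ) i with h | h
      · rw [Nat.sub_eq_zero_of_le h, Nat.cast_zero]
        linarith
      · rw [Nat.cast_sub h]
        linarith
  refine Finset.mem_map.2 ⟨b, Finset.mem_product.2 ⟨?_, ?_⟩, rfl⟩
  · exact hwin _ _ ((abs_fst_sub_le_dist hε a b).trans hd)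
  · exact hwin _ _ ((abs_snd_sub_le_dist hε a b).trans hd)

theorem window_le_card_moveSet (hr : 0 ≤ r) (hε : 0 < ε)
    (a : Fin (gridSize n ε) × Fin (gridSize n ε)) :
    (window (⌊r / ε⌋₊ / 2) a.1).card * (window (⌊r / ε⌋₊ / 2) a.2).card ≤
      (moveSet n r ε (gridEquiv n hε a)).card := by
  rw [← Finset.card_product, ← Finset.card_map (gridEquiv n hε).toEmbedding]
  refine Finset.card_le_card fun y hy => ?_
  obtain ⟨b, hb, rfl⟩ := Finset.mem_map.1 hy
  obtain ⟨h1, h2⟩ := Finset.mem_product.1 hb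
  set s := ⌊r / ε⌋₊ with hs
  have hwin : ∀ i j : Fin (gridSize n ε), j ∈ window (s / 2) i →
      |((i : ℕ) : ℝ) - (j : ℕ)| ≤ (s / 2 : ℕ) := by
    intro i j hij
    simp only [window, Finset.mem_filter, Finset.mem_univ, true_and] at hij
    have h1 : ((i : ℕ) : ℝ) ≤ (j : ℕ) + (s / 2 : ℕ) := by exact_mod_cast hij.1
    have h2 : ((j : ℕ) : ℝ) ≤ (i : ℕ) + (s / 2 : ℕ) := by exact_mod_cast hij.2
    rw [abs_le]
    constructor <;> linarith
  have hss : ((s / 2 : ℕ) : ℝ) + (s / 2 : ℕ) ≤ s := by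
    have : s / 2 + s / 2 ≤ s := by omega
    exact_mod_cast this
  have hsr : (s : ℝ) ≤ r / ε := Nat.floor_le (by positivity)
  have : dist (gridEquiv n hε a : EuclideanSpace ℝ (Fin 2)) (gridEquiv n hε b) ≤ r := by
    refine (dist_le_abs_add_abs hε a b).trans ?_
    rw [← le_div_iff₀ hε]
    linarith [hwin _ _ h1, hwin _ _ h2]
  simpa [moveSet] using this

theorem card_moveSet_le (hr : 0 ≤ r) (hε : 0 < ε) (x y : grid n ε) :
    (moveSet n r ε x).card ≤ 16 * (moveSet n r ε y).card := by
  obtain ⟨a, rfl⟩ := (gridEquiv n hε).surjective x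
  obtain ⟨b, rfl⟩ := (gridEquiv n hε).surjective y
  calc (moveSet n r ε (gridEquiv n hε a)).card
      ≤ (window ⌊r / ε⌋₊ a.1).card * (window ⌊r / ε⌋₊ a.2).card := card_moveSet_le_window hε a
    _ ≤ (4 * (window (⌊r / ε⌋₊ / 2) b.1).card) * (4 * (window (⌊r / ε⌋₊ / 2) b.2).card) :=
        Nat.mul_le_mul (card_window_le _ _ _) (card_window_le _ _ _)
    _ = 16 * ((window (⌊r / ε⌋₊ / 2) b.1).card * (window (⌊r / ε⌋₊ / 2) b.2).card) := by ring
    _ ≤ 16 * (moveSet n r ε (gridEquiv n hε b)).card :=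
        Nat.mul_le_mul_left _ (window_le_card_moveSet hr hε b)

theorem card_moveSet_pos (hr : 0 ≤ r) (x : grid n ε) : 0 < (moveSet n r ε x).card :=
  Finset.card_pos.2 ⟨x, by simp [moveSet, hr]⟩

theorem card_grid (hε : 0 < ε) : Fintype.card (grid n ε) = gridSize n ε ^ 2 := by
  rw [← Fintype.card_congr (gridEquiv n hε), Fintype.card_prod, Fintype.card_fin, sq]

theorem stationaryProb_nonneg (x : grid n ε) : 0 ≤ stationaryProb n r ε x := by
  unfold stationaryProb
  positivity

theorem sum_card_moveSet_pos (hr : 0 ≤ r) (hε : 0 < ε) :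
    0 < ∑ y : grid n ε, ((moveSet n r ε y).card : ℝ) := by
  have : Nonempty (grid n ε) := ⟨gridEquiv n hε (⟨0, gridSize_pos n ε⟩, ⟨0, gridSize_pos n ε⟩)⟩
  exact Finset.sum_pos (fun y _ => Nat.cast_pos.2 (card_moveSet_pos hr y)) Finset.univ_nonempty

theorem sum_stationaryProb (hr : 0 ≤ r) (hε : 0 < ε) : ∑ x, stationaryProb n r ε x = 1 := by
  unfold stationaryProb
  rw [← Finset.sum_div, div_self (sum_card_moveSet_pos hr hε).ne']

theorem stationaryProb_bounds (hr : 0 ≤ r) (hε : 0 < ε) (x : grid n ε) :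
    1 / (16 * (gridSize n ε : ℝ) ^ 2) ≤ stationaryProb n r ε x ∧
      stationaryProb n r ε x ≤ 16 / (gridSize n ε : ℝ) ^ 2 := by
  have hS := sum_card_moveSet_pos (n := n) hr hε
  have hN : (0 : ℝ) < gridSize n ε := Nat.cast_pos.2 (gridSize_pos n ε)
  have hcard : ((Finset.univ : Finset (grid n ε)).card : ℝ) = (gridSize n ε : ℝ) ^ 2 := by
    rw [Finset.card_univ, card_grid hε]
    push_cast
    rfl
  unfold stationaryProb
  constructor
  · rw [div_le_div_iff₀ (by positivity) hS, one_mul]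
    have := Finset.sum_le_card_nsmul Finset.univ (fun y : grid n ε => ((moveSet n r ε y).card : ℝ))
      (16 * (moveSet n r ε x).card) fun y _ => by exact_mod_cast card_moveSet_le hr hε y x
    rw [nsmul_eq_mul, hcard] at this
    linarith
  · rw [div_le_div_iff₀ hS (by positivity)]
    have := Finset.card_nsmul_le_sum Finset.univ
      (fun y : grid n ε => (16 * (moveSet n r ε y).card : ℝ))
      ((moveSet n r ε x).card) fun y _ => by exact_mod_cast card_moveSet_le hr hε x y
    rw [nsmul_eq_mul, hcard, ← Finset.mul_sum] at this
    linarith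

end Moves

/-! ### The cells -/

/-- The cell of the index `i` when `N` indices are cut into `m` consecutive cells. -/
def lineCell {N m : ℕ} (hm : 0 < m) (i : Fin N) : Fin m :=
  ⟨i * m / N, Nat.div_lt_of_lt_mul (Nat.mul_lt_mul_of_pos_right i.2 hm)⟩

theorem lineCell_eq_iff {N m : ℕ} (hm : 0 < m) (i : Fin N) (a : Fin m) :
    lineCell hm i = a ↔ (a : ℕ) * N ≤ i * m ∧ (i : ℕ) * m < a * N + N := by
  have hN : 0 < N := i.pos
  rw [Fin.ext_iff, lineCell, Nat.div_eq_iff hN]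
  omega

/-- Each of the `m` cells has between `N / (2m)` and `2N / m` of the `N` indices. -/
theorem card_lineCell_bounds {N m : ℕ} (hm : 0 < m) (hmN : m ≤ N) (a : Fin m) :
    N ≤ 2 * m * (Finset.univ.filter fun i : Fin N => lineCell hm i = a).card ∧
      m * (Finset.univ.filter fun i : Fin N => lineCell hm i = a).card ≤ 2 * N := by
  set d := N / m with hd
  have hd1 : 1 ≤ d := (Nat.one_le_div_iff hm).2 hmN
  have hdN : m * d ≤ N := Nat.mul_div_le N m
  have hNd : N < m * d + m := Nat.lt_mul_div_succ N hm
  -- the first index of the cell is `⌈a N / m⌉`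
  obtain ⟨i₀, h1, h2⟩ : ∃ i₀ : ℕ, a * N ≤ i₀ * m ∧ i₀ * m < a * N + m := by
    refine ⟨(a * N + (m - 1)) / m, ?_, ?_⟩
    · have := Nat.lt_div_mul_add (a := a * N + (m - 1)) hm
      omega
    · have := Nat.div_mul_le_self (a * N + (m - 1)) m
      omega
  have haN : (a : ℕ) * N + N ≤ m * N := by
    have : ((a : ℕ) + 1) * N ≤ m * N := Nat.mul_le_mul_right _ a.2
    linarith
  have hlast : i₀ + (d - 1) < N := by
    have : (i₀ + (d - 1)) * m < N * m := by
      obtain ⟨e, he⟩ : ∃ e, d = e + 1 := ⟨d - 1, by omega⟩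
      rw [he] at hdN ⊢
      simp only [Nat.add_sub_cancel]
      nlinarith
    exact lt_of_mul_lt_mul_right this (Nat.zero_le _)
  have hlow : d ≤ (Finset.univ.filter fun i : Fin N => lineCell hm i = a).card := by
    have hsub : Finset.Icc (⟨i₀, by omega⟩ : Fin N) ⟨i₀ + (d - 1), hlast⟩ ⊆
        Finset.univ.filter fun i : Fin N => lineCell hm i = a := by
      intro i hi
      simp only [Finset.mem_Icc, Fin.le_def] at hi
      simp only [Finset.mem_filter, Finset.mem_univ, true_and, lineCell_eq_iff]
      refine ⟨h1.trans (Nat.mul_le_mul_right _ hi.1), ?_⟩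
      have := Nat.mul_le_mul_right m hi.2
      obtain ⟨e, he⟩ : ∃ e, d = e + 1 := ⟨d - 1, by omega⟩
      rw [he] at this hdN
      simp only [Nat.add_sub_cancel] at this
      nlinarith
    have := Finset.card_le_card hsub
    rw [Fin.card_Icc] at this
    dsimp only at this
    omega
  have hup : (Finset.univ.filter fun i : Fin N => lineCell hm i = a).card ≤ d + 1 := by
    have hsub : (Finset.univ.filter fun i : Fin N => lineCell hm i = a) ⊆
        Finset.Icc (⟨i₀, by omega⟩ : Fin N) ⟨min (i₀ + d) (N - 1), by omega⟩ := by
      intro i hi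
      have hiN := i.2
      simp only [Finset.mem_filter, Finset.mem_univ, true_and, lineCell_eq_iff] at hi
      simp only [Finset.mem_Icc, Fin.le_def]
      constructor
      · by_contra! hlt
        have := Nat.mul_le_mul_right m (Nat.succ_le_of_lt hlt)
        have h3 : ((i : ℕ) + 1) * m = i * m + m := by ring
        rw [Nat.succ_eq_add_one, h3] at this
        omega
      · refine le_min ?_ (by omega)
        by_contra! hlt
        have := Nat.mul_le_mul_right m (Nat.succ_le_of_lt hlt)
        rw [Nat.succ_eq_add_one] at this
        nlinarith
    have := Finset.card_le_card hsub
    rw [Fin.card_Icc] at this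
    dsimp only at this
    omega
  constructor
  · nlinarith [Nat.mul_le_mul_left m hlow]
  · nlinarith [Nat.mul_le_mul_left m hup]

theorem abs_sub_mul_le {N m : ℕ} (hm : 0 < m) {i j : Fin N} {a b : Fin m}
    (hi : lineCell hm i = a) (hj : lineCell hm j = b) {k : ℕ} (hab : (a : ℕ) ≤ b + k)
    (hba : (b : ℕ) ≤ a + k) : |((i : ℕ) : ℝ) - (j : ℕ)| * m ≤ (k + 1) * N := by
  rw [lineCell_eq_iff] at hi hj
  have h1 : (i : ℕ) * m ≤ j * m + (k + 1) * N := by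
    nlinarith [Nat.mul_le_mul_right N hab, hi.2, hj.1]
  have h2 : (j : ℕ) * m ≤ i * m + (k + 1) * N := by
    nlinarith [Nat.mul_le_mul_right N hba, hj.2, hi.1]
  have h1' : ((i : ℕ) : ℝ) * m ≤ (j : ℕ) * m + (k + 1) * N := by exact_mod_cast h1
  have h2' : ((j : ℕ) : ℝ) * m ≤ (i : ℕ) * m + (k + 1) * N := by exact_mod_cast h2
  have hm' : (0 : ℝ) < m := Nat.cast_pos.2 hm
  rw [← le_div_iff₀ hm', abs_le]
  constructor
  · rw [neg_le, le_div_iff₀ hm']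
    linarith
  · rw [le_div_iff₀ hm']
    linarith

/-- The cell, among `m × m` ones, of a grid point. -/
def gridCell {n m : ℕ} {ε : ℝ} (hε : 0 < ε) (hm : 0 < m) (x : grid n ε) : Fin m × Fin m :=
  (lineCell hm ((gridEquiv n hε).symm x).1, lineCell hm ((gridEquiv n hε).symm x).2)

section Cells

variable {n m : ℕ} {r R ε : ℝ}

theorem dist_le_of_gridCell (hε : 0 < ε) (hm : 0 < m) (hR : 3 * (gridSize n ε * ε) ≤ R * m)
    (x y : grid n ε) (h : gridCell hε hm x = gridCell hε hm y ∨
      (cellGraph m).Adj (gridCell hε hm x) (gridCell hε hm y)) :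
    dist (x : EuclideanSpace ℝ (Fin 2)) y ≤ R := by
  obtain ⟨a, rfl⟩ := (gridEquiv n hε).surjective x
  obtain ⟨b, rfl⟩ := (gridEquiv n hε).surjective y
  have hm' : (0 : ℝ) < m := Nat.cast_pos.2 hm
  have hN : (0 : ℝ) ≤ gridSize n ε := Nat.cast_nonneg _
  set u := |((a.1 : ℕ) : ℝ) - (b.1 : ℕ)| with hu
  set v := |((a.2 : ℕ) : ℝ) - (b.2 : ℕ)| with hv
  have key : (u + v) * m ≤ 3 * gridSize n ε := by
    simp only [gridCell, Equiv.symm_apply_apply, cellGraph, SimpleGraph.boxProd_adj,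
      SimpleGraph.pathGraph_adj, Prod.mk.injEq] at h
    rcases h with ⟨h1, h2⟩ | ⟨h1, h2⟩ | ⟨h1, h2⟩
    · have e1 := abs_sub_mul_le hm h1 (Eq.refl (lineCell hm b.1)) (k := 0) le_rfl le_rfl
      have e2 := abs_sub_mul_le hm h2 (Eq.refl (lineCell hm b.2)) (k := 0) le_rfl le_rfl
      push_cast at e1 e2
      linarith
    · have e1 := abs_sub_mul_le hm (Eq.refl (lineCell hm a.1)) (Eq.refl (lineCell hm b.1)) (k := 1)
        (by omega) (by omega)
      have e2 := abs_sub_mul_le hm h2 (Eq.refl (lineCell hm b.2)) (k := 0) le_rfl le_rfl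
      push_cast at e1 e2
      linarith
    · have e1 := abs_sub_mul_le hm (Eq.refl (lineCell hm a.2)) (Eq.refl (lineCell hm b.2)) (k := 1)
        (by omega) (by omega)
      have e2 := abs_sub_mul_le hm h2 (Eq.refl (lineCell hm b.1)) (k := 0) le_rfl le_rfl
      push_cast at e1 e2
      linarith
  refine (dist_le_abs_add_abs hε a b).trans ?_
  refine le_of_mul_le_mul_right ?_ hm'
  calc (u + v) * ε * m = (u + v) * m * ε := by ring
    _ ≤ 3 * gridSize n ε * ε := by gcongr
    _ ≤ R * m := by linarith

open Classical in
/-- The stationary probability of each cell is within a factor `64` of `1 / m²`. -/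
theorem sum_stationaryProb_gridCell (hr : 0 ≤ r) (hε : 0 < ε) (hm : 0 < m)
    (hmN : m ≤ gridSize n ε) (c : Fin m × Fin m) :
    1 / (64 * (m : ℝ) ^ 2) ≤ ∑ x with x ∈ gridCell (n := n) hε hm ⁻¹' {c}, stationaryProb n r ε x ∧
      ∑ x with x ∈ gridCell (n := n) hε hm ⁻¹' {c}, stationaryProb n r ε x ≤ 64 / (m : ℝ) ^ 2 := by
  set N := gridSize n ε with hNdef
  set f : Fin m → ℝ := fun a => ((Finset.univ.filter fun i : Fin N => lineCell hm i = a).card : ℝ)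
    with hf
  have hm' : (0 : ℝ) < m := Nat.cast_pos.2 hm
  have hN : (0 : ℝ) < N := Nat.cast_pos.2 (gridSize_pos n ε)
  have hfb : ∀ a, N / (2 * m) ≤ f a ∧ f a ≤ 2 * N / m := by
    intro a
    obtain ⟨h1, h2⟩ := card_lineCell_bounds hm hmN a
    constructor
    · rw [div_le_iff₀ (by positivity), mul_comm]
      simp only [hf]
      exact_mod_cast h1
    · rw [le_div_iff₀ hm', mul_comm]
      simp only [hf]
      exact_mod_cast h2
  have hcard : ((Finset.univ.filter fun x : grid n ε =>
      x ∈ gridCell (n := n) hε hm ⁻¹' {c}).card : ℝ) = f c.1 * f c.2 := by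
    rw [hf]
    dsimp only
    rw [← Nat.cast_mul, ← Finset.card_product, ← Finset.card_map (gridEquiv n hε).toEmbedding]
    congr 2
    ext x
    obtain ⟨a, rfl⟩ := (gridEquiv n hε).surjective x
    simp [gridCell, Prod.ext_iff]
  constructor
  · have := Finset.card_nsmul_le_sum (Finset.univ.filter fun x : grid n ε =>
      x ∈ gridCell (n := n) hε hm ⁻¹' {c}) (stationaryProb n r ε) _
      fun x _ => (stationaryProb_bounds hr hε x).1
    rw [nsmul_eq_mul, hcard] at this
    refine le_trans ?_ this
    calc 1 / (64 * (m : ℝ) ^ 2) = N / (2 * m) * (N / (2 * m)) * (1 / (16 * (N : ℝ) ^ 2)) := by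
          field_simp
          norm_num
      _ ≤ _ := by
          gcongr
          · exact (hfb _).1
          · exact (hfb _).1
  · have := Finset.sum_le_card_nsmul (Finset.univ.filter fun x : grid n ε =>
      x ∈ gridCell (n := n) hε hm ⁻¹' {c}) (stationaryProb n r ε) _
      fun x _ => (stationaryProb_bounds hr hε x).2
    rw [nsmul_eq_mul, hcard] at this
    refine this.trans ?_
    calc f c.1 * f c.2 * (16 / (N : ℝ) ^ 2) ≤ (2 * N / m) * (2 * N / m) * (16 / (N : ℝ) ^ 2) := by
          gcongr
          · exact (hfb _).2
          · exact (hfb _).2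
      _ = 64 / (m : ℝ) ^ 2 := by
          field_simp
          norm_num

end Cells

/-! ### Balance of the stationary positions -/

open Classical in
/-- With `q` a fixed fraction of the mean number of nodes in a cell, the stationary positions leave
some cell with fewer than `q` or more than `182² q` nodes with probability at most
`2 m² exp (-q)`. -/
theorem sum_jointStationaryProb_not_isBalanced_le {n m : ℕ} {r ε q : ℝ} (hr : 0 ≤ r) (hε : 0 < ε)
    (hm : 0 < m) (hmN : m ≤ gridSize n ε) (hq : q = n / (256 * (m : ℝ) ^ 2)) :
    ∑ x with x ∈ {x : Fin n → grid n ε | ¬ IsBalanced (fun i => gridCell hε hm (x i)) q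
      (182 ^ 2 * q)}, jointStationaryProb n r ε x ≤ 2 * (m : ℝ) ^ 2 * Real.exp (-q) := by
  have hm' : (0 : ℝ) < m := Nat.cast_pos.2 hm
  have hq0 : 0 ≤ q := by rw [hq]; positivity
  -- the two kinds of bad events, as opaque sets, for the two tails of the Chernoff bound
  obtain ⟨low, hlow_mem⟩ : ∃ low : Fin m × Fin m → Set (Fin n → grid n ε), ∀ c x,
      x ∈ low c ↔ ((x ⁻¹' (gridCell hε hm ⁻¹' {c})).ncard : ℝ) < q :=
    ⟨fun c => {x | _}, fun _ _ => Iff.rfl⟩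
  obtain ⟨high, hhigh_mem⟩ : ∃ high : Fin m × Fin m → Set (Fin n → grid n ε), ∀ c x,
      x ∈ high c ↔ 182 ^ 2 * q < ((x ⁻¹' (gridCell hε hm ⁻¹' {c})).ncard : ℝ) :=
    ⟨fun c => {x | _}, fun _ _ => Iff.rfl⟩
  have hnonneg : ∀ x, 0 ≤ jointStationaryProb n r ε x := fun x =>
    Finset.prod_nonneg fun i _ => stationaryProb_nonneg _
  -- the mean is at least `4 q`, as `q = n / (256 m²)`; the exponent is `-2 q + q` for `θ = -1`
  have hlow : ∀ c, ∑ x with x ∈ low c, jointStationaryProb n r ε x ≤ Real.exp (-q) := by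
    intro c
    have hchernoff := sum_prod_le_exp (ι := Fin n) (B := low c) (ρ := stationaryProb n r ε)
      stationaryProb_nonneg (sum_stationaryProb hr hε) (gridCell hε hm ⁻¹' {c}) (-1) (-q)
      fun x hx => by linarith [(hlow_mem c x).1 hx]
    refine hchernoff.trans (Real.exp_le_exp.2 ?_)
    clear hchernoff
    have hp := (sum_stationaryProb_gridCell hr hε hm hmN c).1
    generalize ∑ x with x ∈ gridCell (n := n) hε hm ⁻¹' {c}, stationaryProb n r ε x = p at hp ⊢
    have he : Real.exp (-1) ≤ 1 / 2 := Real.exp_neg_one_lt_half.le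
    have hp0 : 0 ≤ p := le_trans (by positivity) hp
    have h1 : p * (Real.exp (-1) - 1) ≤ -(p / 2) := by nlinarith
    have h2 : 2 * q ≤ n * (p / 2) := by
      calc 2 * q = n * (1 / (64 * (m : ℝ) ^ 2) / 2) := by rw [hq]; field_simp; ring
        _ ≤ n * (p / 2) := by gcongr
    have h3 := mul_le_mul_of_nonneg_left h1 (Nat.cast_nonneg (α := ℝ) n)
    rw [Fintype.card_fin]
    linarith
  -- the mean is at most `2 ^ 14 q`, and `2 ^ 15 q` is less than `182² q` by more than `q`
  have hhigh : ∀ c, ∑ x with x ∈ high c, jointStationaryProb n r ε x ≤ Real.exp (-q) := by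
    intro c
    have hchernoff := sum_prod_le_exp (ι := Fin n) (B := high c) (ρ := stationaryProb n r ε)
      stationaryProb_nonneg (sum_stationaryProb hr hε) (gridCell hε hm ⁻¹' {c}) 1 (182 ^ 2 * q)
      fun x hx => by linarith [(hhigh_mem c x).1 hx]
    refine hchernoff.trans (Real.exp_le_exp.2 ?_)
    clear hchernoff
    have hp := (sum_stationaryProb_gridCell hr hε hm hmN c)
    generalize ∑ x with x ∈ gridCell (n := n) hε hm ⁻¹' {c}, stationaryProb n r ε x = p at hp ⊢
    have he : Real.exp 1 ≤ 3 := Real.exp_one_lt_three.le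
    have hp0 : 0 ≤ p := le_trans (by positivity) hp.1
    have h1 : p * (Real.exp 1 - 1) ≤ p * 2 := by gcongr; linarith
    have h2 : n * (p * 2) ≤ 32768 * q := by
      calc n * (p * 2) ≤ n * (64 / (m : ℝ) ^ 2 * 2) := by gcongr; exact hp.2
        _ = 32768 * q := by rw [hq]; field_simp; ring
    have h3 := mul_le_mul_of_nonneg_left h1 (Nat.cast_nonneg (α := ℝ) n)
    rw [Fintype.card_fin]
    linarith
  have hite : ∀ (p : Prop) x, 0 ≤ if p then jointStationaryProb n r ε x else 0 := by
    intro p x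
    split_ifs
    exacts [hnonneg x, le_rfl]
  calc _ ≤ ∑ x, ∑ c, ((if x ∈ low c then jointStationaryProb n r ε x else 0) +
        if x ∈ high c then jointStationaryProb n r ε x else 0) := by
        rw [Finset.sum_filter]
        refine Finset.sum_le_sum fun x _ => ?_
        have hsum : ∀ c, 0 ≤ (if x ∈ low c then jointStationaryProb n r ε x else 0) +
            if x ∈ high c then jointStationaryProb n r ε x else 0 :=
          fun c => add_nonneg (hite _ x) (hite _ x)
        split_ifs with hx
        · obtain ⟨c, hc⟩ := not_forall.1 hx
          refine le_trans ?_ (Finset.single_le_sum (fun c _ => hsum c) (Finset.mem_univ c))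
          rw [not_and_or, not_le, not_le] at hc
          rcases hc with hc | hc
          · rw [if_pos ((hlow_mem c x).2 hc)]
            exact le_add_of_nonneg_right (hite _ x)
          · rw [if_pos ((hhigh_mem c x).2 hc)]
            exact le_add_of_nonneg_left (hite _ x)
        · exact Finset.sum_nonneg fun c _ => hsum c
    _ = ∑ c, (∑ x with x ∈ low c, jointStationaryProb n r ε x +
        ∑ x with x ∈ high c, jointStationaryProb n r ε x) := by
        rw [Finset.sum_comm]
        simp only [Finset.sum_filter, Finset.sum_add_distrib]
    _ ≤ ∑ _c : Fin m × Fin m, (Real.exp (-q) + Real.exp (-q)) :=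
        Finset.sum_le_sum fun c _ => add_le_add (hlow c) (hhigh c)
    _ = 2 * (m : ℝ) ^ 2 * Real.exp (-q) := by
        rw [Finset.sum_const, Finset.card_univ, Fintype.card_prod, Fintype.card_fin, nsmul_eq_mul]
        push_cast
        ring

end GeomMEG
end

open GeomMEG in
theorem mainTheorem4 :
    ∃ c : ℝ, 0 < c ∧ ∃ C : ℝ, 0 < C ∧
      ∀ (n : ℕ) (r R ε : ℝ), 2 ≤ n → 0 ≤ r → 0 < ε → ε ≤ 1 → ε < R →
        c * √(Real.log n) ≤ R → R ≤ √(n : ℝ) →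
        ∀ {Ω : Type*} [MeasurableSpace Ω] (μ : Measure Ω) [IsProbabilityMeasure μ]
          (G : ℕ → Ω → SimpleGraph (Fin n)),
          GeomMEG.IsStationaryGeometricMEG μ n r R ε G →
          1 - 1 / (n : ℝ) ≤
            μ.real {ω | ∃ T : ℕ, GeomMEG.floodingTime (fun t => G t ω) = (T : ℕ∞) ∧
              (T : ℝ) ≤ C * (√(n : ℝ) / R + Real.log (Real.log R))} := by
  classical
  -- `500² / (49 · 256) ≥ 19` gives a failure probability of at most `n ^ 18 · n ^ (-19)`, and
  -- `163086 = 7 · 23298` bounds the `23297 m + 1` steps, as `m ≤ 7 √n / R`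
  refine ⟨500, by norm_num, 163086, by norm_num, ?_⟩
  rintro n r R ε hn hr hε hε1 - hcR hRn Ω _ μ _ G ⟨P, hP, hP0, hG⟩
  have hn2 : (2 : ℝ) ≤ n := by exact_mod_cast hn
  have hn0 : (0 : ℝ) < n := by linarith
  set w := √(n : ℝ) with hw
  have hw2 : w ^ 2 = n := Real.sq_sqrt hn0.le
  have hlog2 : 0.64 ≤ Real.log n := by
    have := Real.log_le_log (by norm_num) hn2
    linarith [Real.log_two_gt_d9]
  have hR400 : 400 ≤ R := by
    have : 0.8 ≤ √(Real.log n) := Real.le_sqrt_of_sq_le (by norm_num at hlog2 ⊢; exact hlog2)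
    linarith
  have hR0 : 0 < R := by linarith
  have hw0 : 0 < w := by linarith
  -- the side `√n / m` of a cell is comparable to `R`
  set m := ⌈6 * w / R⌉₊ with hm_def
  have hwR : 1 ≤ w / R := (one_le_div hR0).2 hRn
  have hm6 : 6 * w / R ≤ m := Nat.le_ceil _
  have hm7 : (m : ℝ) ≤ 7 * (w / R) := by
    have := (Nat.ceil_lt_add_one (a := 6 * w / R) (by positivity)).le
    have h6 : 6 * w / R = 6 * (w / R) := mul_div_assoc _ _ _
    linarith
  have hm1 : (1 : ℝ) ≤ m := by
    rw [mul_div_assoc] at hm6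
    linarith
  have hm : 0 < m := by exact_mod_cast (by linarith : (0 : ℝ) < m)
  have hmR : (m : ℝ) * R ≤ 7 * w := by
    rw [mul_div_assoc', le_div_iff₀ hR0] at hm7
    exact hm7
  have hmw : (m : ℝ) ≤ w := by nlinarith
  have hNw : w ≤ gridSize n ε := by
    have h1 : w / ε < gridSize n ε := by
      rw [gridSize, Nat.cast_add, Nat.cast_one]
      exact Nat.lt_floor_add_one _
    have h2 : w ≤ w / ε := le_div_self hw0.le hε hε1
    linarith
  have hmN : m ≤ gridSize n ε := by exact_mod_cast hmw.trans hNw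
  have hNε : gridSize n ε * ε ≤ 2 * w := by
    have h1 : (⌊w / ε⌋₊ : ℝ) ≤ w / ε := Nat.floor_le (by positivity)
    rw [le_div_iff₀ hε] at h1
    rw [gridSize, Nat.cast_add, Nat.cast_one, add_mul]
    linarith
  have hlink : 3 * (gridSize n ε * ε) ≤ R * m := by
    rw [div_le_iff₀ hR0] at hm6
    linarith
  set q : ℝ := n / (256 * (m : ℝ) ^ 2) with hq
  have hq0 : 0 < q := by positivity
  -- the potential has range `2 √n` and grows by `√q / 728 = √n / (11648 m)` in each step
  set T := 23297 * m with hT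
  have hsqrt : √q = w / (16 * m) := by
    rw [hq, ← hw2, show w ^ 2 / (256 * (m : ℝ) ^ 2) = (w / (16 * m)) ^ 2 by
      rw [div_pow, mul_pow]; norm_num]
    exact Real.sqrt_sq (by positivity)
  have hTlarge : 2 * √(Nat.card (Fin n) : ℝ) < T * (√q / (4 * 182)) := by
    rw [Nat.card_eq_fintype_card, Fintype.card_fin, hsqrt, hT]
    push_cast
    rw [show 23297 * (m : ℝ) * (w / (16 * m) / (4 * 182)) = 23297 / 11648 * w by
      field_simp; norm_num]
    linarith
  set bad : ℕ → Set Ω := fun t => {ω | P t ω ∈ {x : Fin n → grid n ε | ¬ IsBalanced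
    (fun i => gridCell hε hm (x i)) q (182 ^ 2 * q)}} with hbad_def
  have hbad : ∀ t, μ.real (bad t) ≤ 2 * (m : ℝ) ^ 2 * Real.exp (-q) := by
    intro t
    rw [hbad_def]
    dsimp only
    rw [measureReal_mem_eq_sum (hP.1 t)]
    simp_rw [hP.measureReal_eq_of_stationary hP0
      (sum_jointStationaryProb_mul_jointMoveProb n hr ε) t]
    -- only the instances deciding membership differ
    convert sum_jointStationaryProb_not_isBalanced_le hr hε hm hmN hq
  set good : Set Ω := {ω | ∃ T : ℕ, GeomMEG.floodingTime (fun t => G t ω) = (T : ℕ∞) ∧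
    (T : ℝ) ≤ 163086 * (w / R + Real.log (Real.log R))} with hgood
  have hcover : Set.univ ⊆ good ∪ ⋃ t ∈ Finset.range (T + 1), bad t := by
    intro ω _
    by_cases hω : ω ∈ ⋃ t ∈ Finset.range (T + 1), bad t
    · exact Or.inr hω
    left
    have hbal : ∀ t ≤ T, IsBalanced (fun i => gridCell hε hm (P t ω i)) q (182 ^ 2 * q) := by
      intro t ht
      by_contra h
      exact hω (Set.mem_biUnion (Finset.mem_coe.2 (Finset.mem_range.2 (by omega))) h)
    have hlinks : ∀ t ≤ T, LinksCells (G t ω) (fun i => gridCell hε hm (P t ω i)) := by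
      intro t _ u v huv h
      rw [hG]
      exact ⟨huv, dist_le_of_gridCell hε hm hlink _ _ h⟩
    have hflood := floodingTime_le
      (informed_eq_univ (by norm_num : (1 : ℝ) ≤ 182) hq0 hlinks hbal hTlarge)
    obtain ⟨S, hS⟩ := ENat.ne_top_iff_exists.1 (ne_top_of_le_ne_top (ENat.natCast_ne_top _) hflood)
    refine ⟨S, hS.symm, ?_⟩
    rw [← hS] at hflood
    have hST : S ≤ T + 1 := by exact_mod_cast hflood
    have hST' : (S : ℝ) ≤ 23297 * m + 1 := by
      rw [hT] at hST
      exact_mod_cast hST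
    have hloglog : 0 ≤ Real.log (Real.log R) := by
      apply Real.log_nonneg
      rw [Real.le_log_iff_exp_le hR0]
      linarith [Real.exp_one_lt_three]
    linarith
  have hunion : 1 ≤ μ.real good + (T + 1) * (2 * (m : ℝ) ^ 2 * Real.exp (-q)) := by
    calc (1 : ℝ) = μ.real Set.univ := probReal_univ.symm
      _ ≤ μ.real (good ∪ ⋃ t ∈ Finset.range (T + 1), bad t) := measureReal_mono hcover
      _ ≤ μ.real good + μ.real (⋃ t ∈ Finset.range (T + 1), bad t) := measureReal_union_le _ _
      _ ≤ μ.real good + ∑ t ∈ Finset.range (T + 1), μ.real (bad t) := by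
          gcongr
          exact measureReal_biUnion_finset_le _ _
      _ ≤ μ.real good + ∑ _t ∈ Finset.range (T + 1), 2 * (m : ℝ) ^ 2 * Real.exp (-q) := by
          gcongr
          exact hbad _
      _ = _ := by
          rw [Finset.sum_const, Finset.card_range, nsmul_eq_mul]
          push_cast
          rfl
  -- as `q` is at least a constant times `R² ≥ c² log n`, a large `c` makes the failure
  -- probability polynomially small
  have hqlog : 19 * Real.log n ≤ q := by
    have hR2 : 250000 * Real.log n ≤ R ^ 2 := by
      have h1 : (500 * √(Real.log n)) ^ 2 ≤ R ^ 2 := by gcongr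
      rw [mul_pow, Real.sq_sqrt (by linarith)] at h1
      linarith
    have h2 : (m : ℝ) ^ 2 * R ^ 2 ≤ 49 * n := by
      calc (m : ℝ) ^ 2 * R ^ 2 = (m * R) ^ 2 := by ring
        _ ≤ (7 * w) ^ 2 := by gcongr
        _ = 49 * n := by rw [mul_pow, hw2]; norm_num
    have h3 : (m : ℝ) ^ 2 * (250000 * Real.log n) ≤ 49 * n := le_trans (by gcongr) h2
    rw [hq, le_div_iff₀ (by positivity)]
    nlinarith [mul_nonneg (sq_nonneg (m : ℝ)) (by linarith : 0 ≤ Real.log n)]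
  have hexp : Real.exp (-q) * n ^ 19 ≤ 1 := by
    have h1 : (n : ℝ) ^ 19 = Real.exp (19 * Real.log n) := by
      rw [← Real.exp_log hn0, ← Real.exp_nat_mul, Real.log_exp]
      norm_num
    rw [h1, ← Real.exp_add]
    exact Real.exp_le_one_iff.2 (by linarith)
  have hsmall : (T + 1) * (2 * (m : ℝ) ^ 2 * Real.exp (-q)) ≤ 1 / n := by
    have h1 : ((T : ℝ) + 1) * (2 * (m : ℝ) ^ 2) ≤ (n : ℝ) ^ 18 := by
      calc ((T : ℝ) + 1) * (2 * (m : ℝ) ^ 2) ≤ (23298 * m) * (2 * (m : ℝ) ^ 2) := by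
            gcongr
            rw [hT]
            push_cast
            linarith
        _ ≤ (23298 * m) * (2 * (m : ℝ) ^ 2) * m := le_mul_of_one_le_right (by positivity) hm1
        _ = 46596 * (m : ℝ) ^ 4 := by ring
        _ ≤ 2 ^ 16 * w ^ 4 := by gcongr; norm_num
        _ = 2 ^ 16 * (n : ℝ) ^ 2 := by rw [← hw2]; ring
        _ ≤ (n : ℝ) ^ 16 * n ^ 2 := by gcongr
        _ = (n : ℝ) ^ 18 := by ring
    rw [le_div_iff₀ hn0]
    calc (T + 1) * (2 * (m : ℝ) ^ 2 * Real.exp (-q)) * n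
        = ((T + 1) * (2 * (m : ℝ) ^ 2)) * (Real.exp (-q) * n) := by ring
      _ ≤ (n : ℝ) ^ 18 * (Real.exp (-q) * n) := by gcongr
      _ = Real.exp (-q) * n ^ 19 := by ring
      _ ≤ 1 := hexp
  linarith
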